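/- Let $n\ge 2$ and let $\mathbf x_1,\dots,\mathbf x_n$ be an i.i.d. sample from a $p$-variate elliptical distribution with mean vector $\boldsymbol\mu\in\mathbb R^p$ and positive definite covariance matrix $\mathbf M\in\mathbb R^{p\times p}$, that is, from a distribution with Lebesgue density $$f(\mathbf x)=C\,|\mathbf M|^{-1/2}\,g\big((\mathbf x-\boldsymbol\mu)^\top\mathbf M^{-1}(\mathbf x-\boldsymbol\mu)\big),$$ where $C>0$ is a normalizing constant and the density generator $g:[0,\infty)\to[0,\infty)$ is scaled so that $\mathbf M$ is the covariance matrix. Suppose that the distribution has finite fourth order moments. Let $$\bar{\mathbf x}=\frac1n\sum_{i=1}^n\mathbf x_i,\qquad \mathbf S=\frac1{n-1}\sum_{i=1}^n(\mathbf x_i-\bar{\mathbf x})(\mathbf x_i-\bar{\mathbf x})^\top,$$ and let $\kappa=\dfrac{\mathbb E[r^4]}{p(p+2)}-1$, where $r=\sqrt{(\mathbf x-\boldsymbol\mu)^\top\mathbf M^{-1}(\mathbf x-\boldsymbol\mu)}$ and $\mathbf x$ has density $f$, be the elliptical kurtosis parameter. Let $\mathbf K_p=\sum_{i,j=1}^p\mathbf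 e_i\mathbf e_j^\top\otimes\mathbf e_j\mathbf e_i^\top$ be the commutation matrix, where $\mathbf e_1,\dots,\mathbf e_p$ is the canonical basis of $\mathbb R^p$, and let $\mathrm{vec}$ denote the stacking of the columns of a matrix. Then the entries of $\mathbf S$ are square integrable, and the $p^2\times p^2$ covariance matrix of $\mathrm{vec}(\mathbf S)$ is $$\mathrm{var}(\mathrm{vec}(\mathbf S))=\Big(\frac1{n-1}+\frac{\kappa}{n}\Big)(\mathbf I+\mathbf K_p)(\mathbf M\otimes\mathbf M)+\frac{\kappa}{n}\,\mathrm{vec}(\mathbf M)\,\mathrm{vec}(\mathbf M)^\top .$$ -/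

import Mathlib

open MeasureTheory ProbabilityTheory
open scoped Matrix Kronecker

namespace EllipticalSCM

noncomputable section

/-- The quadratic form `(x - μ)ᵀ M⁻¹ (x - μ)`. -/
def quadForm {p : ℕ} (μ : Fin p → ℝ) (M : Matrix (Fin p) (Fin p) ℝ) (x : Fin p → ℝ) : ℝ :=
  (x - μ) ⬝ᵥ (M⁻¹ *ᵥ (x - μ))

/-- The generating variate `r = √((x - μ)ᵀ M⁻¹ (x - μ))`. -/
def generatingVariate {p : ℕ} (μ : Fin p → ℝ) (M : Matrix (Fin p) (Fin p) ℝ)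
    (x : Fin p → ℝ) : ℝ :=
  √(quadForm μ M x)

/-- `ν` is the elliptical distribution on `ℝᵖ` with mean vector `μ`, positive definite covariance
matrix `M` and density generator `g : [0, ∞) → [0, ∞)` (only the values of `g` on `[0, ∞)`
matter): it is the probability measure with Lebesgue density
`C |M|^(-1/2) g((x - μ)ᵀ M⁻¹ (x - μ))`, where `C` is a normalizing constant and `g` is scaled so
that `M` is the covariance matrix. -/
structure IsElliptical {p : ℕ} (ν : Measure (Fin p → ℝ)) (μ : Fin p → ℝ)
    (M : Matrix (Fin p) (Fin p) ℝ) (g : ℝ → ℝ) : Prop where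
  isProbabilityMeasure : IsProbabilityMeasure ν
  posDef : M.PosDef
  measurable_generator : Measurable g
  generator_nonneg : ∀ t, 0 ≤ t → 0 ≤ g t
  density : ∃ C : ℝ, 0 < C ∧
    ν = volume.withDensity fun x => ENNReal.ofReal (C * (√M.det)⁻¹ * g (quadForm μ M x))
  memLp_two : ∀ j, MemLp (fun x : Fin p → ℝ => x j) 2 ν
  mean_eq : ∀ j, ∫ x, x j ∂ν = μ j
  cov_eq : ∀ j k, cov[fun x : Fin p → ℝ => x j, fun x => x k; ν] = M j k

/-- The elliptical kurtosis parameter `κ = E[r⁴] / (p (p + 2)) - 1`. -/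
def ellipticalKurtosis {p : ℕ} (ν : Measure (Fin p → ℝ)) (μ : Fin p → ℝ)
    (M : Matrix (Fin p) (Fin p) ℝ) : ℝ :=
  (∫ x, generatingVariate μ M x ^ 4 ∂ν) / ((p : ℝ) * ((p : ℝ) + 2)) - 1

/-- The sample mean vector of `x₁, …, xₙ`. -/
def sampleMean {n p : ℕ} (x : Fin n → Fin p → ℝ) : Fin p → ℝ :=
  (1 / (n : ℝ)) • ∑ i, x i

/-- The sample covariance matrix `(1 / (n - 1)) ∑ᵢ (xᵢ - x̄) (xᵢ - x̄)ᵀ`. -/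
def sampleCov {n p : ℕ} (x : Fin n → Fin p → ℝ) : Matrix (Fin p) (Fin p) ℝ :=
  (1 / ((n : ℝ) - 1)) •
    ∑ i, Matrix.vecMulVec (x i - sampleMean x) (x i - sampleMean x)

/-- The commutation matrix `∑ᵢⱼ eᵢ eⱼᵀ ⊗ eⱼ eᵢᵀ`. -/
def commutationMatrix (p : ℕ) : Matrix (Fin p × Fin p) (Fin p × Fin p) ℝ :=
  ∑ i, ∑ j, Matrix.single i j (1 : ℝ) ⊗ₖ Matrix.single j i (1 : ℝ)

/-- The covariance matrix of a random vector. -/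
def covMatrix {Ω ι : Type*} [MeasurableSpace Ω] (P : Measure Ω) (Y : Ω → ι → ℝ) :
    Matrix ι ι ℝ :=
  Matrix.of fun a b => cov[fun ω => Y ω a, fun ω => Y ω b; P]

end

end EllipticalSCM

/-! The density depends on `x` only through its `M⁻¹`-distance to `μ`, so the law is invariant under
every `M⁻¹`-orthogonal reflection centred at `μ`. Two vectors of equal `M`-length are exchanged by
such a reflection, hence the fourth moment of `u ⬝ᵥ (x - μ)` is a constant times `(u ⬝ᵥ M *ᵥ u) ^
2`. Computing `E[r⁴]` identifies the constant as `3 (κ + 1)` (`IsElliptical.integral_pow_four`).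

Fourth cumulants of independent centred variables add (`integral_finset_sum_pow`). This gives the
fourth moment of every linear form in the whole sample: a Gaussian part plus `3 κ` times a sum of
squares over the observations. Polarization (`integral_four_mul_of_integral_pow_four`) turns it into
all mixed fourth moments.

Finally `S` is a double sum of products of centred coordinates whose weights form the centring
projection divided by `n - 1`. Three contractions of these weights, equal to `1`, `1 / n` and `1 /
(n - 1)`, produce the coefficients of the formula. -/

namespace EllipticalSCM

/-! ### Integrability and polarization of fourth moments -/

section FourthPowers

variable {Ω : Type*} [MeasurableSpace Ω] {P : Measure Ω}

theorem memLp_two_mul_of_four {f h : Ω → ℝ} (hf : MemLp f 4 P) (hh : MemLp h 4 P) :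
    MemLp (fun ω => f ω * h ω) 2 P := by
  have : ENNReal.HolderTriple 4 4 2 := ⟨by
    rw [← two_mul, show (4 : ENNReal) = 2 * 2 by norm_num,
      ENNReal.mul_inv (by norm_num) (by norm_num), ← mul_assoc,
      ENNReal.mul_inv_cancel (by norm_num) (by norm_num), one_mul]⟩
  exact hh.mul hf

theorem integrable_four_mul {f₁ f₂ f₃ f₄ : Ω → ℝ} (h₁ : MemLp f₁ 4 P) (h₂ : MemLp f₂ 4 P)
    (h₃ : MemLp f₃ 4 P) (h₄ : MemLp f₄ 4 P) :
    Integrable (fun ω => f₁ ω * f₂ ω * (f₃ ω * f₄ ω)) P :=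
  (memLp_two_mul_of_four h₁ h₂).integrable_mul (memLp_two_mul_of_four h₃ h₄)

theorem integrable_pow_four {f : Ω → ℝ} (h : MemLp f 4 P) :
    Integrable (fun ω => f ω ^ 4) P :=
  (integrable_four_mul h h h h).congr (ae_of_all _ fun ω => by ring)

/-- Polarization of fourth moments: if the fourth moments of a linear family of random variables
are a combination of squares of quadratic forms, the mixed fourth moments are the polarized
combination. -/
theorem integral_four_mul_of_integral_pow_four {V K : Type*} [AddCommGroup V] [Module ℝ V]
    [Fintype K] (ℓ : Ω → V →ₗ[ℝ] ℝ) (hℓ : ∀ v, MemLp (fun ω => ℓ ω v) 4 P)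
    (c : K → ℝ) (B : K → LinearMap.BilinForm ℝ V) (hB : ∀ k v w, B k v w = B k w v)
    (h : ∀ v, ∫ ω, ℓ ω v ^ 4 ∂P = 3 * ∑ k, c k * B k v v ^ 2) (v₁ v₂ v₃ v₄ : V) :
    ∫ ω, ℓ ω v₁ * ℓ ω v₂ * (ℓ ω v₃ * ℓ ω v₄) ∂P =
      ∑ k, c k * (B k v₁ v₂ * B k v₃ v₄ + B k v₁ v₃ * B k v₂ v₄ + B k v₁ v₄ * B k v₂ v₃) := by
  have hi : ∀ v, Integrable (fun ω => ℓ ω v ^ 4) P := fun v => integrable_pow_four (hℓ v)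
  -- Signed sum over the eight choices of signs of `v₂, v₃, v₄`: each fourth power contributes `4! =
  -- 24` times the full product, and `8 * 24 = 192`; all other monomials cancel.
  have key : ∫ ω, 192 * (ℓ ω v₁ * ℓ ω v₂ * (ℓ ω v₃ * ℓ ω v₄)) ∂P =
      ∫ ω, (ℓ ω (v₁ + v₂ + v₃ + v₄) ^ 4 - ℓ ω (v₁ + v₂ + v₃ - v₄) ^ 4
        - ℓ ω (v₁ + v₂ - v₃ + v₄) ^ 4 + ℓ ω (v₁ + v₂ - v₃ - v₄) ^ 4
        - ℓ ω (v₁ - v₂ + v₃ + v₄) ^ 4 + ℓ ω (v₁ - v₂ + v₃ - v₄) ^ 4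
        + ℓ ω (v₁ - v₂ - v₃ + v₄) ^ 4 - ℓ ω (v₁ - v₂ - v₃ - v₄) ^ 4) ∂P := by
    congr 1 with ω
    simp only [map_add, map_sub]
    ring
  rw [integral_const_mul, integral_sub (by fun_prop) (hi _), integral_add (by fun_prop) (hi _),
    integral_add (by fun_prop) (hi _), integral_sub (by fun_prop) (hi _),
    integral_add (by fun_prop) (hi _), integral_sub (by fun_prop) (hi _),
    integral_sub (hi _) (hi _)] at key
  simp only [h] at key
  refine mul_left_cancel₀ (show (192 : ℝ) ≠ 0 by norm_num) (key.trans ?_)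
  simp only [Finset.mul_sum, ← Finset.sum_add_distrib, ← Finset.sum_sub_distrib]
  refine Finset.sum_congr rfl fun k _ => ?_
  simp only [map_add, map_sub, LinearMap.add_apply, LinearMap.sub_apply, hB k v₂ v₁, hB k v₃ v₁,
    hB k v₄ v₁, hB k v₃ v₂, hB k v₄ v₂, hB k v₄ v₃]
  ring

end FourthPowers

/-! ### Reflection invariance of the elliptical law -/

section Law

variable {p : ℕ}

/-- The reflection `y ↦ y - s (k ⬝ y) M k`. -/
noncomputable def reflection (M : Matrix (Fin p) (Fin p) ℝ) (k : Fin p → ℝ) (s : ℝ) :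
    (Fin p → ℝ) →ₗ[ℝ] (Fin p → ℝ) where
  toFun y := y - (s * (k ⬝ᵥ y)) • (M *ᵥ k)
  map_add' x y := by
    ext i; simp [dotProduct_add]; ring
  map_smul' r y := by
    ext i; simp; ring

theorem reflection_apply (M : Matrix (Fin p) (Fin p) ℝ) (k : Fin p → ℝ) (s : ℝ) (y : Fin p → ℝ) :
    reflection M k s y = y - (s * (k ⬝ᵥ y)) • (M *ᵥ k) := rfl

theorem reflection_reflection {M : Matrix (Fin p) (Fin p) ℝ} {k : Fin p → ℝ} {s : ℝ}
    (hs : s * (k ⬝ᵥ M *ᵥ k) = 2) (y : Fin p → ℝ) :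
    reflection M k s (reflection M k s y) = y := by
  ext i
  simp only [reflection_apply, dotProduct_sub, dotProduct_smul, Pi.sub_apply, Pi.smul_apply,
    smul_eq_mul]
  linear_combination s * (k ⬝ᵥ y) * (M *ᵥ k) i * hs

/-- An involution has determinant `±1`, so it preserves Lebesgue measure. -/
theorem measurePreserving_reflection {M : Matrix (Fin p) (Fin p) ℝ} {k : Fin p → ℝ} {s : ℝ}
    (hs : s * (k ⬝ᵥ M *ᵥ k) = 2) :
    MeasurePreserving (reflection M k s) volume volume := by
  have hdet : LinearMap.det (reflection M k s) * LinearMap.det (reflection M k s) = 1 := by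
    rw [← LinearMap.det_comp, show reflection M k s ∘ₗ reflection M k s = LinearMap.id from
      LinearMap.ext (reflection_reflection hs), LinearMap.det_id]
  refine ⟨(LinearMap.continuous_on_pi _).measurable, ?_⟩
  have habs : |LinearMap.det (reflection M k s)| = 1 := by
    rcases mul_self_eq_one_iff.1 hdet with h | h <;> simp [h]
  rw [Real.map_linearMap_volume_pi_eq_smul_volume_pi (fun h => by simp [h] at hdet), abs_inv,
    habs]
  simp

theorem mulVec_dotProduct_symm {M : Matrix (Fin p) (Fin p) ℝ} (hM : Mᵀ = M) (v w : Fin p → ℝ) :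
    v ⬝ᵥ M *ᵥ w = w ⬝ᵥ M *ᵥ v := by
  rw [Matrix.dotProduct_mulVec, dotProduct_comm, ← Matrix.mulVec_transpose, hM]

/-- In the inner product given by `M⁻¹`, pairing with `M *ᵥ k` is `k ⬝ᵥ ·`. With `s` normalized by
`hs`, the map is thus the orthogonal reflection in the direction `M *ᵥ k`. -/
theorem reflection_quadForm {M : Matrix (Fin p) (Fin p) ℝ} (hM : M.PosDef) {k : Fin p → ℝ} {s : ℝ}
    (hs : s * (k ⬝ᵥ M *ᵥ k) = 2) (y : Fin p → ℝ) :
    reflection M k s y ⬝ᵥ M⁻¹ *ᵥ reflection M k s y = y ⬝ᵥ M⁻¹ *ᵥ y := by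
  have hT : Mᵀ = M := by simpa using hM.isHermitian.eq
  have hT' : (M⁻¹)ᵀ = M⁻¹ := by rw [Matrix.transpose_nonsing_inv, hT]
  have hinv : M⁻¹ *ᵥ (M *ᵥ k) = k := by
    rw [Matrix.mulVec_mulVec, Matrix.nonsing_inv_mul _ ((Matrix.isUnit_iff_isUnit_det _).1 hM.isUnit),
      Matrix.one_mulVec]
  have h1 : y ⬝ᵥ M⁻¹ *ᵥ (M *ᵥ k) = k ⬝ᵥ y := by rw [hinv, dotProduct_comm]
  have h2 : (M *ᵥ k) ⬝ᵥ M⁻¹ *ᵥ y = k ⬝ᵥ y := by rw [mulVec_dotProduct_symm hT', h1]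
  have h3 : (M *ᵥ k) ⬝ᵥ M⁻¹ *ᵥ (M *ᵥ k) = k ⬝ᵥ M *ᵥ k := by rw [hinv, dotProduct_comm]
  simp only [reflection_apply, Matrix.mulVec_sub, Matrix.mulVec_smul, dotProduct_sub,
    sub_dotProduct, dotProduct_smul, smul_dotProduct, smul_eq_mul, h1, h2, h3]
  linear_combination s * (k ⬝ᵥ y) ^ 2 * hs

variable {ν : Measure (Fin p → ℝ)} {μ : Fin p → ℝ} {M : Matrix (Fin p) (Fin p) ℝ} {g : ℝ → ℝ}

theorem measurable_quadForm (μ : Fin p → ℝ) (M : Matrix (Fin p) (Fin p) ℝ) :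
    Measurable (quadForm μ M) := by
  have : Continuous (quadForm μ M) := by unfold quadForm; fun_prop
  exact this.measurable

theorem IsElliptical.measurePreserving_reflection (hν : IsElliptical ν μ M g) {k : Fin p → ℝ}
    {s : ℝ} (hs : s * (k ⬝ᵥ M *ᵥ k) = 2) :
    MeasurePreserving (fun x => reflection M k s (x - μ) + μ) ν ν := by
  have hT : MeasurePreserving (fun x => reflection M k s (x - μ) + μ) volume volume :=
    (measurePreserving_add_right volume μ).comp
      ((EllipticalSCM.measurePreserving_reflection hs).comp (measurePreserving_sub_right volume μ))
  refine ⟨hT.measurable, ?_⟩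
  obtain ⟨C, -, hdens⟩ := hν.density
  have hmeas : Measurable fun x =>
      ENNReal.ofReal (C * (√M.det)⁻¹ * g (quadForm μ M x)) :=
    ((hν.measurable_generator.comp (measurable_quadForm μ M)).const_mul _).ennreal_ofReal
  ext A hA
  rw [Measure.map_apply hT.measurable hA, hdens, withDensity_apply _ (hT.measurable hA),
    withDensity_apply _ hA, ← hT.setLIntegral_comp_preimage hA hmeas]
  congr 1 with x
  simp only [quadForm, add_sub_cancel_right, reflection_quadForm hν.posDef hs]

/-- The reflection with `k = u - w` pulls the functional `u` back to `w`, because the two have the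
same `M`-length. -/
theorem IsElliptical.integral_pow_four_congr (hν : IsElliptical ν μ M g) {u w : Fin p → ℝ}
    (huw : u ⬝ᵥ M *ᵥ u = w ⬝ᵥ M *ᵥ w) :
    ∫ x, (u ⬝ᵥ (x - μ)) ^ 4 ∂ν = ∫ x, (w ⬝ᵥ (x - μ)) ^ 4 ∂ν := by
  rcases eq_or_ne u w with rfl | hne
  · rfl
  have hT : Mᵀ = M := by simpa using hν.posDef.isHermitian.eq
  have hpos : 0 < (u - w) ⬝ᵥ M *ᵥ (u - w) := by
    simpa using hν.posDef.dotProduct_mulVec_pos (sub_ne_zero.2 hne)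
  have hs : 2 / ((u - w) ⬝ᵥ M *ᵥ (u - w)) * ((u - w) ⬝ᵥ M *ᵥ (u - w)) = 2 :=
    div_mul_cancel₀ _ hpos.ne'
  have hmp := hν.measurePreserving_reflection hs
  have hm : AEStronglyMeasurable (fun x : Fin p → ℝ => (u ⬝ᵥ (x - μ)) ^ 4)
      (ν.map (fun x => reflection M (u - w) (2 / ((u - w) ⬝ᵥ M *ᵥ (u - w))) (x - μ) + μ)) :=
    Continuous.aestronglyMeasurable (by fun_prop)
  rw [← hmp.map_eq, integral_map hmp.measurable.aemeasurable hm, hmp.map_eq]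
  congr 1 with x
  congr 1
  set s := 2 / ((u - w) ⬝ᵥ M *ᵥ (u - w))
  rw [add_sub_cancel_right, reflection_apply]
  -- Equality of the `M`-lengths gives `(u - w) ⬝ᵥ M *ᵥ (u - w) = 2 * (u ⬝ᵥ M *ᵥ (u - w))`, so the
  -- reflection subtracts exactly one copy of `u - w` from `u`.
  have h2 : s * (u ⬝ᵥ M *ᵥ (u - w)) = 1 := by
    simp only [Matrix.mulVec_sub, dotProduct_sub, sub_dotProduct] at hs ⊢
    linear_combination hs / 2 + s / 2 * huw - s / 2 * mulVec_dotProduct_symm hT u w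
  simp only [dotProduct_sub u, dotProduct_smul, smul_eq_mul]
  rw [mul_right_comm, h2, sub_dotProduct, dotProduct_sub, dotProduct_sub]
  ring

end Law

/-! ### Moments of linear forms and the kurtosis parameter -/

section Kurtosis

variable {p : ℕ} {ν : Measure (Fin p → ℝ)} {μ : Fin p → ℝ} {M : Matrix (Fin p) (Fin p) ℝ}
  {g : ℝ → ℝ}

theorem memLp_dotProduct_sub [IsFiniteMeasure ν] {q : ENNReal}
    (h : ∀ j, MemLp (fun x : Fin p → ℝ => x j) q ν) (μ v : Fin p → ℝ) :
    MemLp (fun x => v ⬝ᵥ (x - μ)) q ν :=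
  memLp_finsetSum _ fun j _ => ((h j).sub (memLp_const (μ j))).const_mul (v j)

theorem IsElliptical.exists_integral_pow_four (hν : IsElliptical ν μ M g) :
    ∃ c : ℝ, ∀ u : Fin p → ℝ,
      ∫ x, (u ⬝ᵥ (x - μ)) ^ 4 ∂ν = 3 * (c * (u ⬝ᵥ M *ᵥ u) ^ 2) := by
  by_cases h0 : ∃ u₀ : Fin p → ℝ, u₀ ≠ 0
  · obtain ⟨u₀, hu₀⟩ := h0
    have hpos : ∀ u : Fin p → ℝ, u ≠ 0 → 0 < u ⬝ᵥ M *ᵥ u := fun u hu => by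
      simpa using hν.posDef.dotProduct_mulVec_pos hu
    refine ⟨(∫ x, (u₀ ⬝ᵥ (x - μ)) ^ 4 ∂ν) / (3 * (u₀ ⬝ᵥ M *ᵥ u₀) ^ 2), fun u => ?_⟩
    rcases eq_or_ne u 0 with rfl | hu
    · simp
    have hq₀ := hpos u₀ hu₀
    have hq := hpos u hu
    -- Homogeneity: `t • u` has the `M`-length of the reference vector `u₀`.
    set t := √((u₀ ⬝ᵥ M *ᵥ u₀) / (u ⬝ᵥ M *ᵥ u)) with ht
    have ht2 : t ^ 2 = (u₀ ⬝ᵥ M *ᵥ u₀) / (u ⬝ᵥ M *ᵥ u) := Real.sq_sqrt (div_pos hq₀ hq).le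
    have hcongr := hν.integral_pow_four_congr (u := t • u) (w := u₀) (by
      simp only [Matrix.mulVec_smul, dotProduct_smul, smul_dotProduct, smul_eq_mul]
      rw [← mul_assoc, ← sq, ht2, div_mul_cancel₀ _ hq.ne'])
    simp only [smul_dotProduct, smul_eq_mul, mul_pow, integral_const_mul] at hcongr
    rw [← hcongr, show t ^ 4 = (t ^ 2) ^ 2 by ring, ht2]
    field_simp
  · push Not at h0
    exact ⟨0, fun u => by simp [h0 u]⟩

theorem IsElliptical.integral_dotProduct_mul (hν : IsElliptical ν μ M g)
    (u v : Fin p → ℝ) :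
    ∫ x, (u ⬝ᵥ (x - μ)) * (v ⬝ᵥ (x - μ)) ∂ν = u ⬝ᵥ M *ᵥ v := by
  have := hν.isProbabilityMeasure
  have hY : ∀ j, MemLp (fun x : Fin p → ℝ => x j - μ j) 2 ν := fun j =>
    (hν.memLp_two j).sub (memLp_const _)
  have hexp : ∀ x : Fin p → ℝ, (u ⬝ᵥ (x - μ)) * (v ⬝ᵥ (x - μ)) =
      ∑ j, ∑ k, u j * v k * ((x j - μ j) * (x k - μ k)) := fun x => by
    simp only [dotProduct, Finset.sum_mul_sum, Pi.sub_apply]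
    exact Finset.sum_congr rfl fun j _ => Finset.sum_congr rfl fun k _ => by ring
  have hint : ∀ j k, Integrable
      (fun x : Fin p → ℝ => u j * v k * ((x j - μ j) * (x k - μ k))) ν :=
    fun j k => ((hY j).integrable_mul (hY k)).const_mul _
  simp only [hexp]
  rw [integral_finsetSum _ fun j _ => integrable_finsetSum _ fun k _ => hint j k]
  simp only [dotProduct, Matrix.mulVec, Finset.mul_sum]
  refine Finset.sum_congr rfl fun j _ => ?_
  rw [integral_finsetSum _ fun k _ => hint j k]
  refine Finset.sum_congr rfl fun k _ => ?_
  have hcov := hν.cov_eq j k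
  rw [covariance, hν.mean_eq, hν.mean_eq] at hcov
  rw [integral_const_mul, hcov]
  ring

theorem IsElliptical.integral_dotProduct (hν : IsElliptical ν μ M g) (u : Fin p → ℝ) :
    ∫ x, u ⬝ᵥ (x - μ) ∂ν = 0 := by
  have := hν.isProbabilityMeasure
  have hint : ∀ j, Integrable (fun x : Fin p → ℝ => x j) ν := fun j =>
    (hν.memLp_two j).integrable (by norm_num)
  simp only [dotProduct, Pi.sub_apply]
  have hint' : ∀ j, Integrable (fun x : Fin p → ℝ => u j * (x j - μ j)) ν := fun j =>
    ((hint j).sub (integrable_const _)).const_mul _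
  rw [integral_finsetSum _ fun j _ => hint' j]
  refine Finset.sum_eq_zero fun j _ => ?_
  rw [integral_const_mul, integral_sub (hint j) (integrable_const _), hν.mean_eq]
  simp

/-- Contracting the Gaussian fourth-moment tensor of `M` with two copies of `N = M⁻¹`: the pairing
parallel to `N` gives `p * p`, each of the two crossed pairings gives `p`. This explains the
normalization `p (p + 2)` in `κ`. -/
theorem sum_inv_mul_isserlis {M N : Matrix (Fin p) (Fin p) ℝ} (hM : Mᵀ = M) (hN : Nᵀ = N)
    (hNM : N * M = 1) :
    ∑ a, ∑ b, ∑ c, ∑ d,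
      N a b * N c d * (M a b * M c d + M a c * M b d + M a d * M b c) = (p : ℝ) * (p + 2) := by
  have hM' : ∀ a b, M a b = M b a := fun a b => congrFun (congrFun hM b) a
  have hN' : ∀ a b, N a b = N b a := fun a b => congrFun (congrFun hN b) a
  have hδ : ∀ a c, ∑ b, N a b * M b c = if a = c then 1 else 0 := fun a c => by
    rw [← Matrix.mul_apply, hNM, Matrix.one_apply]
  have h1 : ∑ a, ∑ b, ∑ c, ∑ d, N a b * N c d * (M a b * M c d) = (p : ℝ) * p := by
    have : ∑ a, ∑ b, N a b * M a b = (p : ℝ) := by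
      rw [Finset.sum_congr rfl fun a _ => Finset.sum_congr rfl fun b _ => by rw [hM' a b]]
      simp [hδ]
    calc _ = (∑ a, ∑ b, N a b * M a b) * ∑ c, ∑ d, N c d * M c d := by
          simp only [Finset.sum_mul, Finset.mul_sum]
          refine Finset.sum_congr rfl fun a _ => Finset.sum_congr rfl fun b _ =>
            Finset.sum_congr rfl fun c _ => Finset.sum_congr rfl fun d _ => by ring
      _ = _ := by rw [this]
  have h2 : ∑ a, ∑ b, ∑ c, ∑ d, N a b * N c d * (M a c * M b d) = (p : ℝ) := by
    have hb : ∀ a, ∀ c, ∑ b, ∑ d, N a b * N c d * (M a c * M b d) =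
        M a c * N a c := fun a c => by
      rw [Finset.sum_comm]
      calc _ = ∑ d, M a c * N c d * ∑ b, N a b * M b d := by
            simp only [Finset.mul_sum]
            exact Finset.sum_congr rfl fun d _ => Finset.sum_congr rfl fun b _ => by ring
        _ = M a c * N a c := by simp [hδ, hN' c a]
    calc _ = ∑ a, ∑ c, ∑ b, ∑ d, N a b * N c d * (M a c * M b d) :=
          Finset.sum_congr rfl fun a _ => Finset.sum_comm
      _ = ∑ a, ∑ c, N a c * M c a := by
          simp only [hb]
          exact Finset.sum_congr rfl fun a _ => Finset.sum_congr rfl fun c _ => by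
            rw [hM' a c]; ring
      _ = _ := by simp [hδ]
  have h3 : ∑ a, ∑ b, ∑ c, ∑ d, N a b * N c d * (M a d * M b c) = (p : ℝ) := by
    rw [← h2]
    refine Finset.sum_congr rfl fun a _ => Finset.sum_congr rfl fun b _ => ?_
    rw [Finset.sum_comm]
    exact Finset.sum_congr rfl fun c _ => Finset.sum_congr rfl fun d _ => by rw [hN' d c]
  simp only [mul_add, Finset.sum_add_distrib, h1, h2, h3]
  ring

theorem IsElliptical.integral_pow_four (hν : IsElliptical ν μ M g)
    (hfourth : ∀ j, MemLp (fun x : Fin p → ℝ => x j) 4 ν) (u : Fin p → ℝ) :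
    ∫ x, (u ⬝ᵥ (x - μ)) ^ 4 ∂ν =
      3 * ((ellipticalKurtosis ν μ M + 1) * (u ⬝ᵥ M *ᵥ u) ^ 2) := by
  have := hν.isProbabilityMeasure
  -- For `p = 0` the quotient in `κ` divides by zero, but both sides vanish.
  rcases Nat.eq_zero_or_pos p with rfl | hp
  · simp
  obtain ⟨c, hc⟩ := hν.exists_integral_pow_four
  suffices hr : ∫ x, generatingVariate μ M x ^ 4 ∂ν = c * (p * (p + 2)) by
    have hp' : (0 : ℝ) < p := by exact_mod_cast hp
    rw [hc, ellipticalKurtosis, hr, mul_div_assoc, div_self (by positivity)]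
    ring
  have hT : Mᵀ = M := by simpa using hν.posDef.isHermitian.eq
  have hT' : (M⁻¹)ᵀ = M⁻¹ := by rw [Matrix.transpose_nonsing_inv, hT]
  have hY : ∀ j, MemLp (fun x : Fin p → ℝ => x j - μ j) 4 ν := fun j =>
    (hfourth j).sub (memLp_const _)
  -- Polarization with the single form `M`; then `r⁴` is a combination of these mixed moments with
  -- coefficients from `M⁻¹`, so its mean determines `c`.
  have hmix : ∀ a b d e, ∫ x, (x a - μ a) * (x b - μ b) * ((x d - μ d) * (x e - μ e)) ∂ν =
      c * (M a b * M d e + M a d * M b e + M a e * M b d) := fun a b d e => by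
    have := integral_four_mul_of_integral_pow_four (P := ν) (K := Unit)
      (fun x => (dotProductBilin ℝ ℝ).flip (x - μ)) (memLp_dotProduct_sub hfourth μ) (fun _ => c)
      (fun _ => Matrix.toBilin' M)
      (fun _ v w => by simpa [Matrix.toBilin'_apply'] using mulVec_dotProduct_symm hT v w)
      (fun v => by simpa [Matrix.toBilin'_apply'] using hc v)
      (Pi.single a 1) (Pi.single b 1) (Pi.single d 1) (Pi.single e 1)
    simpa [Matrix.toBilin'_apply'] using this
  have hr4 : ∀ x, generatingVariate μ M x ^ 4 = ∑ a, ∑ b, ∑ d, ∑ e, M⁻¹ a b * M⁻¹ d e *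
      ((x a - μ a) * (x b - μ b) * ((x d - μ d) * (x e - μ e))) := fun x => by
    have h0 : 0 ≤ quadForm μ M x := by
      simpa [quadForm] using hν.posDef.inv.posSemidef.dotProduct_mulVec_nonneg (x - μ)
    have hq : quadForm μ M x = ∑ a, ∑ b, M⁻¹ a b * ((x a - μ a) * (x b - μ b)) := by
      simp only [quadForm, dotProduct, Matrix.mulVec, Finset.mul_sum, Pi.sub_apply]
      exact Finset.sum_congr rfl fun a _ => Finset.sum_congr rfl fun b _ => by ring
    rw [generatingVariate, show √(quadForm μ M x) ^ 4 = (√(quadForm μ M x) ^ 2) ^ 2 by ring,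
      Real.sq_sqrt h0, sq, hq]
    simp only [Finset.sum_mul, Finset.mul_sum]
    exact Finset.sum_congr rfl fun a _ => Finset.sum_congr rfl fun b _ =>
      Finset.sum_congr rfl fun d _ => Finset.sum_congr rfl fun e _ => by ring
  have hint : ∀ a b d e, Integrable (fun x : Fin p → ℝ => M⁻¹ a b * M⁻¹ d e *
      ((x a - μ a) * (x b - μ b) * ((x d - μ d) * (x e - μ e)))) ν := fun a b d e =>
    (integrable_four_mul (hY a) (hY b) (hY d) (hY e)).const_mul _
  simp only [hr4]
  rw [← sum_inv_mul_isserlis hT hT' (Matrix.nonsing_inv_mul _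
    ((Matrix.isUnit_iff_isUnit_det _).1 hν.posDef.isUnit)), Finset.mul_sum,
    integral_finsetSum _ fun a _ => integrable_finsetSum _ fun b _ =>
      integrable_finsetSum _ fun d _ => integrable_finsetSum _ fun e _ => hint a b d e]
  refine Finset.sum_congr rfl fun a _ => ?_
  rw [integral_finsetSum _ fun b _ => integrable_finsetSum _ fun d _ =>
    integrable_finsetSum _ fun e _ => hint a b d e, Finset.mul_sum]
  refine Finset.sum_congr rfl fun b _ => ?_
  rw [integral_finsetSum _ fun d _ => integrable_finsetSum _ fun e _ => hint a b d e,
    Finset.mul_sum]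
  refine Finset.sum_congr rfl fun d _ => ?_
  rw [integral_finsetSum _ fun e _ => hint a b d e, Finset.mul_sum]
  refine Finset.sum_congr rfl fun e _ => ?_
  rw [integral_const_mul, hmix]
  ring

end Kurtosis

/-! ### Fourth moments of sums of independent centred variables -/

section IndependentSums

variable {Ω : Type*} [MeasurableSpace Ω] {P : Measure Ω}

/-- Additivity of the fourth cumulant `E[Y⁴] - 3 E[Y²]²`. The first two moments are carried along
because the induction on `s` needs them. -/
theorem integral_finset_sum_pow [IsProbabilityMeasure P] {ι : Type*} {Y : ι → Ω → ℝ}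
    (hY : ∀ i, MemLp (Y i) 4 P) (hindep : iIndepFun Y P) (hmean : ∀ i, ∫ ω, Y i ω ∂P = 0)
    (s : Finset ι) :
    ∫ ω, ∑ i ∈ s, Y i ω ∂P = 0 ∧
    ∫ ω, (∑ i ∈ s, Y i ω) ^ 2 ∂P = ∑ i ∈ s, ∫ ω, Y i ω ^ 2 ∂P ∧
    ∫ ω, (∑ i ∈ s, Y i ω) ^ 4 ∂P = ∑ i ∈ s, (∫ ω, Y i ω ^ 4 ∂P - 3 * (∫ ω, Y i ω ^ 2 ∂P) ^ 2)
      + 3 * (∑ i ∈ s, ∫ ω, Y i ω ^ 2 ∂P) ^ 2 := by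
  classical
  have hpow : ∀ {f : Ω → ℝ}, MemLp f 4 P → Integrable f P ∧ Integrable (fun ω => f ω ^ 2) P ∧
      Integrable (fun ω => f ω ^ 3) P ∧ Integrable (fun ω => f ω ^ 4) P := fun {f} hf => by
    have h1 : MemLp (fun _ : Ω => (1 : ℝ)) 4 P := memLp_const 1
    refine ⟨hf.integrable (by norm_num), ?_, ?_, integrable_pow_four hf⟩
    · exact (integrable_four_mul hf hf h1 h1).congr (ae_of_all _ fun ω => by ring)
    · exact (integrable_four_mul hf hf hf h1).congr (ae_of_all _ fun ω => by ring)
  induction s using Finset.induction_on with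
  | empty => simp
  | insert i s hi ih =>
    obtain ⟨ih1, ih2, ih4⟩ := ih
    have hS : MemLp (fun ω => ∑ j ∈ s, Y j ω) 4 P := memLp_finsetSum _ fun j _ => hY j
    have hind : IndepFun (fun ω => ∑ j ∈ s, Y j ω) (Y i) P := by
      have := hindep.indepFun_finsetSum_of_notMem₀ (fun j => (hY j).1.aemeasurable) hi
      convert this using 1
      ext ω; simp
    simp only [Finset.sum_insert hi]
    rw [← ih2]
    set S : Ω → ℝ := fun ω => ∑ j ∈ s, Y j ω
    change _ ∧ ∫ ω, (Y i ω + S ω) ^ 2 ∂P = _ + ∫ ω, S ω ^ 2 ∂P ∧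
      ∫ ω, (Y i ω + S ω) ^ 4 ∂P = _ + 3 * (_ + ∫ ω, S ω ^ 2 ∂P) ^ 2
    change ∫ ω, S ω ∂P = 0 at ih1
    change ∫ ω, S ω ^ 4 ∂P = _ at ih4
    rw [← ih2] at ih4
    change ∫ ω, S ω ^ 4 ∂P = _ + 3 * (∫ ω, S ω ^ 2 ∂P) ^ 2 at ih4
    obtain ⟨s1, s2, s3, s4⟩ := hpow hS
    obtain ⟨y1, y2, y3, y4⟩ := hpow (hY i)
    have hprod : ∀ a b : ℕ, IndepFun (fun ω => S ω ^ a) (fun ω => Y i ω ^ b) P := fun a b =>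
      hind.comp (φ := fun x => x ^ a) (ψ := fun x => x ^ b) (by fun_prop) (by fun_prop)
    have hE : ∀ a b : ℕ, ∫ ω, S ω ^ a * Y i ω ^ b ∂P =
        (∫ ω, S ω ^ a ∂P) * ∫ ω, Y i ω ^ b ∂P := fun a b =>
      (hprod a b).integral_fun_mul_eq_mul_integral (hS.1.pow a) ((hY i).1.pow b)
    -- Cross terms with a first power factor through a zero mean; only `6 S² Y²` survives.
    have e11 := hE 1 1
    have e31 := hE 3 1
    have e13 := hE 1 3
    simp only [pow_one, hmean, ih1, mul_zero, zero_mul] at e11 e31 e13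
    have e22 := hE 2 2
    have i11 : Integrable (fun ω => S ω * Y i ω) P := by
      simpa only [Pi.mul_def, pow_one] using (hprod 1 1).integrable_mul (by simpa using s1) (by simpa using y1)
    have i31 : Integrable (fun ω => S ω ^ 3 * Y i ω) P := by
      simpa only [Pi.mul_def, pow_one] using (hprod 3 1).integrable_mul s3 (by simpa using y1)
    have i13 : Integrable (fun ω => S ω * Y i ω ^ 3) P := by
      simpa only [Pi.mul_def, pow_one] using (hprod 1 3).integrable_mul (by simpa using s1) y3
    have i22 : Integrable (fun ω => S ω ^ 2 * Y i ω ^ 2) P := (hprod 2 2).integrable_mul s2 y2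
    refine ⟨?_, ?_, ?_⟩
    · rw [integral_add y1 s1, hmean, ih1, add_zero]
    · have : ∀ ω, (Y i ω + S ω) ^ 2 = Y i ω ^ 2 + S ω ^ 2 + 2 * (S ω * Y i ω) := fun ω => by ring
      simp only [this]
      rw [integral_add (by fun_prop) (i11.const_mul 2), integral_add y2 s2, integral_const_mul, e11]
      ring
    · have : ∀ ω, (Y i ω + S ω) ^ 4 = Y i ω ^ 4 + S ω ^ 4 + 4 * (S ω ^ 3 * Y i ω)
          + 4 * (S ω * Y i ω ^ 3) + 6 * (S ω ^ 2 * Y i ω ^ 2) := fun ω => by ring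
      simp only [this]
      rw [integral_add (by fun_prop) (i22.const_mul 6),
        integral_add (by fun_prop) (i13.const_mul 4), integral_add (by fun_prop) (i31.const_mul 4),
        integral_add y4 s4, integral_const_mul, integral_const_mul, integral_const_mul, e31, e13,
        e22, ih4]
      ring

end IndependentSums

/-! ### Mixed moments of the sample and moments of the sample covariance -/

section Sample

variable {Ω : Type*} [MeasurableSpace Ω] {P : Measure Ω}
  {n p : ℕ} {ν : Measure (Fin p → ℝ)} {μ : Fin p → ℝ} {M : Matrix (Fin p) (Fin p) ℝ} {g : ℝ → ℝ}
  {X : Fin n → Ω → Fin p → ℝ}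

theorem integral_continuous_comp_of_hasLaw {Y : Ω → Fin p → ℝ} (hY : HasLaw Y ν P)
    {f : (Fin p → ℝ) → ℝ} (hf : Continuous f) : ∫ ω, f (Y ω) ∂P = ∫ x, f x ∂ν :=
  hY.integral_comp hf.aestronglyMeasurable

theorem memLp_comp_of_hasLaw {Y : Ω → Fin p → ℝ} (hY : HasLaw Y ν P) {q : ENNReal}
    {f : (Fin p → ℝ) → ℝ} (hf : MemLp f q ν) : MemLp (fun ω => f (Y ω)) q P :=
  (hY.map_eq ▸ hf : MemLp f q (P.map Y)).comp_of_map hY.aemeasurable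

theorem integral_mul_of_sample (hν : IsElliptical ν μ M g)
    (hlaw : ∀ i, HasLaw (X i) ν P) (hindep : iIndepFun X P) (i j : Fin n) (a b : Fin p) :
    ∫ ω, (X i ω a - μ a) * (X j ω b - μ b) ∂P = if i = j then M a b else 0 := by
  have hzero : ∀ (i : Fin n) (a : Fin p), ∫ ω, (X i ω a - μ a) ∂P = 0 := fun i a => by
    rw [integral_continuous_comp_of_hasLaw (hlaw i)
      (f := fun x : Fin p → ℝ => x a - μ a) (by fun_prop)]
    simpa using hν.integral_dotProduct (Pi.single a 1)
  split_ifs with h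
  · subst h
    rw [integral_continuous_comp_of_hasLaw (hlaw i)
      (f := fun x : Fin p → ℝ => (x a - μ a) * (x b - μ b)) (by fun_prop)]
    simpa using hν.integral_dotProduct_mul (Pi.single a 1) (Pi.single b 1)
  · have hm : ∀ (i : Fin n) (a : Fin p), AEStronglyMeasurable (fun ω => X i ω a - μ a) P :=
      fun i a => (((measurable_pi_apply a).comp_aemeasurable
        (hlaw i).aemeasurable).sub_const (μ a)).aestronglyMeasurable
    have hind : IndepFun (fun ω => X i ω a - μ a) (fun ω => X j ω b - μ b) P :=
      (hindep.indepFun h).comp (φ := fun x : Fin p → ℝ => x a - μ a)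
        (ψ := fun x : Fin p → ℝ => x b - μ b) (by fun_prop) (by fun_prop)
    rw [hind.integral_fun_mul_eq_mul_integral (hm i a) (hm j b), hzero, zero_mul]

variable [IsProbabilityMeasure P]

/-- With `q = v i ⬝ᵥ M *ᵥ v i`, each summand has fourth cumulant `3 (κ + 1) q² - 3 q² = 3 κ q²`. -/
theorem integral_sum_dotProduct_pow_four (hν : IsElliptical ν μ M g)
    (hfourth : ∀ j, MemLp (fun x : Fin p → ℝ => x j) 4 ν)
    (hlaw : ∀ i, HasLaw (X i) ν P) (hindep : iIndepFun X P) (v : Fin n → Fin p → ℝ) :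
    ∫ ω, (∑ i, v i ⬝ᵥ (X i ω - μ)) ^ 4 ∂P =
      3 * (ellipticalKurtosis ν μ M * ∑ i, (v i ⬝ᵥ M *ᵥ v i) ^ 2 +
        (∑ i, v i ⬝ᵥ M *ᵥ v i) ^ 2) := by
  have := hν.isProbabilityMeasure
  have hcont : ∀ i, Continuous fun x : Fin p → ℝ => v i ⬝ᵥ (x - μ) := fun i => by fun_prop
  have hY : ∀ i, MemLp (fun ω => v i ⬝ᵥ (X i ω - μ)) 4 P := fun i =>
    memLp_comp_of_hasLaw (hlaw i) (memLp_dotProduct_sub hfourth μ (v i))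
  have hind : iIndepFun (fun i ω => v i ⬝ᵥ (X i ω - μ)) P :=
    hindep.comp (fun i x => v i ⬝ᵥ (x - μ)) fun i => (hcont i).measurable
  have h1 : ∀ i, ∫ ω, v i ⬝ᵥ (X i ω - μ) ∂P = 0 := fun i => by
    rw [integral_continuous_comp_of_hasLaw (hlaw i) (hcont i), hν.integral_dotProduct]
  have h2 : ∀ i, ∫ ω, (v i ⬝ᵥ (X i ω - μ)) ^ 2 ∂P = v i ⬝ᵥ M *ᵥ v i := fun i => by
    refine (integral_continuous_comp_of_hasLaw (hlaw i) ((hcont i).pow 2)).trans ?_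
    simp only [Pi.pow_apply, sq, hν.integral_dotProduct_mul]
  have h4 : ∀ i, ∫ ω, (v i ⬝ᵥ (X i ω - μ)) ^ 4 ∂P =
      3 * ((ellipticalKurtosis ν μ M + 1) * (v i ⬝ᵥ M *ᵥ v i) ^ 2) := fun i => by
    exact (integral_continuous_comp_of_hasLaw (hlaw i) ((hcont i).pow 4)).trans
      (hν.integral_pow_four hfourth (v i))
  rw [(integral_finset_sum_pow hY hind h1 Finset.univ).2.2]
  simp only [h2, h4]
  rw [mul_add, ← mul_assoc, Finset.mul_sum]
  congr 1
  exact Finset.sum_congr rfl fun i _ => by ring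

theorem integral_four_mul_of_sample (hν : IsElliptical ν μ M g)
    (hfourth : ∀ j, MemLp (fun x : Fin p → ℝ => x j) 4 ν)
    (hlaw : ∀ i, HasLaw (X i) ν P) (hindep : iIndepFun X P)
    (i j k l : Fin n) (a b c d : Fin p) :
    ∫ ω, (X i ω a - μ a) * (X j ω b - μ b) * ((X k ω c - μ c) * (X l ω d - μ d)) ∂P =
      ellipticalKurtosis ν μ M * (M a b * M c d + M a c * M b d + M a d * M b c) *
        (if i = j ∧ i = k ∧ i = l then 1 else 0) +
      ((if i = j ∧ k = l then M a b * M c d else 0) +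
        (if i = k ∧ j = l then M a c * M b d else 0) +
        (if i = l ∧ j = k then M a d * M b c else 0)) := by
  have := hν.isProbabilityMeasure
  have hT : Mᵀ = M := by simpa using hν.posDef.isHermitian.eq
  let B : Fin n → LinearMap.BilinForm ℝ (Fin n → Fin p → ℝ) := fun t =>
    (Matrix.toBilin' M).compl₁₂ (LinearMap.proj t) (LinearMap.proj t)
  have hB : ∀ t v w, B t v w = v t ⬝ᵥ M *ᵥ w t := fun t v w => by
    simp [B, Matrix.toBilin'_apply']
  let ℓ : Ω → (Fin n → Fin p → ℝ) →ₗ[ℝ] ℝ := fun ω =>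
    ∑ i, ((dotProductBilin ℝ ℝ).flip (X i ω - μ)) ∘ₗ LinearMap.proj i
  have hℓ : ∀ ω v, ℓ ω v = ∑ i, v i ⬝ᵥ (X i ω - μ) := fun ω v => by
    simp [ℓ]
  have hmain := integral_four_mul_of_integral_pow_four (P := P) ℓ
    (fun v => by
      simp only [hℓ]
      exact memLp_finsetSum _ fun i _ =>
        memLp_comp_of_hasLaw (hlaw i) (memLp_dotProduct_sub hfourth μ (v i)))
    -- The index `none` carries the pooled form `∑ t, B t` with coefficient `1`, the Gaussian part;
    -- `some t` carries the form of observation `t` with coefficient `κ`.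
    (fun o : Option (Fin n) => o.elim 1 fun _ => ellipticalKurtosis ν μ M)
    (fun o : Option (Fin n) => o.elim (∑ t, B t) B)
    (fun o v w => by
      cases o <;> simp [LinearMap.sum_apply, hB, mulVec_dotProduct_symm hT])
    (fun v => by
      simp only [hℓ, integral_sum_dotProduct_pow_four hν hfourth hlaw hindep,
        Fintype.sum_option, Option.elim, LinearMap.sum_apply, hB, ← Finset.mul_sum]
      ring)
    (Pi.single i (Pi.single a 1)) (Pi.single j (Pi.single b 1)) (Pi.single k (Pi.single c 1))
    (Pi.single l (Pi.single d 1))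
  have hsingle : ∀ (i : Fin n) (a : Fin p) ω,
      ∑ t, (Pi.single i (Pi.single a 1) : Fin n → Fin p → ℝ) t ⬝ᵥ (X t ω - μ) =
        X i ω a - μ a := fun i a ω => by
    rw [Finset.sum_eq_single i (fun t _ ht => by simp [Pi.single_eq_of_ne ht]) (by simp)]
    simp
  have hBs : ∀ t (i j : Fin n) (a b : Fin p),
      B t (Pi.single i (Pi.single a 1)) (Pi.single j (Pi.single b 1)) =
        if t = i ∧ t = j then M a b else 0 := fun t i j a b => by
    rw [hB]
    by_cases hi : t = i
    · subst hi
      by_cases hj : t = j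
      · subst hj; simp
      · simp [hj]
    · simp [hi]
  have hBsum : ∀ (i j : Fin n) (a b : Fin p),
      (∑ t, if t = i ∧ t = j then M a b else 0) = if i = j then M a b else 0 := fun i j a b => by
    rw [Finset.sum_eq_single i (fun t _ ht => by simp [ht]) (by simp)]
    simp
  simp only [hℓ, hsingle, Fintype.sum_option, Option.elim, LinearMap.sum_apply, hBs, hBsum,
    one_mul] at hmain
  rw [hmain, Finset.sum_eq_single i (fun t _ ht => by simp [ht]) (by simp), add_comm]
  congr 1
  · by_cases hj : i = j <;> by_cases hk : i = k <;> by_cases hl : i = l <;> simp [hj, hk, hl]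
    all_goals try subst hj
    all_goals try subst hk
    all_goals try subst hl
    all_goals simp_all
  · simp only [ite_and, mul_ite, ite_mul, zero_mul, mul_zero]
    congr 1
    congr 1
    all_goals split_ifs <;> rfl

/-- The weights of the products `yᵢ yⱼᵀ` in the sample covariance matrix. -/
noncomputable def scmWeight (n : ℕ) (i j : Fin n) : ℝ :=
  (1 / ((n : ℝ) - 1)) * ((if i = j then 1 else 0) - 1 / (n : ℝ))

/-- Centring at the sample mean is insensitive to shifts, so `μ` is arbitrary here: the true mean
serves for moments, `0` for integrability. -/
theorem sampleCov_apply (hn : 2 ≤ n) (x : Fin n → Fin p → ℝ) (μ : Fin p → ℝ) (a b : Fin p) :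
    sampleCov x a b =
      ∑ i, ∑ j, scmWeight n i j * ((x i a - μ a) * (x j b - μ b)) := by
  have hn0 : (n : ℝ) ≠ 0 := by positivity
  have hmean : ∀ a, ∑ i, (x i a - μ a) = n * (sampleMean x a - μ a) := fun a => by
    simp only [sampleMean, Pi.smul_apply, Finset.sum_apply, smul_eq_mul, Finset.sum_sub_distrib,
      Finset.sum_const, Finset.card_univ, Fintype.card_fin, nsmul_eq_mul]
    field_simp
  have hR : ∑ i, ∑ j, scmWeight n i j * ((x i a - μ a) * (x j b - μ b)) =
      (1 / ((n : ℝ) - 1)) * (∑ i, (x i a - μ a) * (x i b - μ b) -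
        1 / (n : ℝ) * ((∑ i, (x i a - μ a)) * ∑ j, (x j b - μ b))) := by
    generalize hu : (fun i => x i a - μ a) = u
    generalize hv : (fun i => x i b - μ b) = v
    simp only [fun i => congrFun hu i, fun i => congrFun hv i]
    simp only [scmWeight, mul_assoc, ← Finset.mul_sum, sub_mul, Finset.sum_sub_distrib,
      Finset.sum_mul, ite_mul, one_mul, zero_mul, Finset.sum_ite_eq, Finset.mem_univ, if_true]
  have hL : ∑ i, (x i a - sampleMean x a) * (x i b - sampleMean x b) =
      ∑ i, (x i a - μ a) * (x i b - μ b) - n * ((sampleMean x a - μ a) * (sampleMean x b - μ b)) := by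
    have : ∀ i, (x i a - sampleMean x a) * (x i b - sampleMean x b) =
        (x i a - μ a) * (x i b - μ b) - (x i a - μ a) * (sampleMean x b - μ b)
          - (sampleMean x a - μ a) * (x i b - μ b)
          + (sampleMean x a - μ a) * (sampleMean x b - μ b) := fun i => by ring
    simp only [this, Finset.sum_add_distrib, Finset.sum_sub_distrib, ← Finset.sum_mul,
      ← Finset.mul_sum, hmean, Finset.sum_const, Finset.card_univ, Fintype.card_fin, nsmul_eq_mul]
    ring
  rw [hR, hmean, hmean]
  simp only [sampleCov, Matrix.smul_apply, Matrix.sum_apply, Matrix.vecMulVec_apply,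
    Pi.sub_apply, smul_eq_mul, hL]
  field_simp

/-- The weights are `(I - J / n) / (n - 1)`, `J` the all-ones matrix, and the projection `I - J / n`
has trace `n - 1`. -/
theorem sum_scmWeight_diag (hn : 2 ≤ n) : ∑ i, scmWeight n i i = 1 := by
  have hn2 : (2 : ℝ) ≤ n := by exact_mod_cast hn
  have hn0 : (n : ℝ) ≠ 0 := by positivity
  have hn1 : (n : ℝ) - 1 ≠ 0 := by linarith
  simp [scmWeight]
  field_simp

/-- Every diagonal weight equals `1 / n`. This sum is the source of `κ / n`. -/
theorem sum_scmWeight_diag_sq (hn : 2 ≤ n) :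
    ∑ i, scmWeight n i i * scmWeight n i i = 1 / (n : ℝ) := by
  have hn2 : (2 : ℝ) ≤ n := by exact_mod_cast hn
  have hn0 : (n : ℝ) ≠ 0 := by positivity
  have hn1 : (n : ℝ) - 1 ≠ 0 := by linarith
  simp [scmWeight]
  field_simp

theorem scmWeight_symm (i j : Fin n) : scmWeight n i j = scmWeight n j i := by
  simp [scmWeight, eq_comm]

/-- The squared Frobenius norm of a projection is its rank, here `n - 1`, divided by `(n - 1) ^ 2`.
-/
theorem sum_scmWeight_sq (hn : 2 ≤ n) :
    ∑ i, ∑ j, scmWeight n i j * scmWeight n i j = 1 / ((n : ℝ) - 1) := by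
  have hn2 : (2 : ℝ) ≤ n := by exact_mod_cast hn
  have hn0 : (n : ℝ) ≠ 0 := by positivity
  have hn1 : (n : ℝ) - 1 ≠ 0 := by linarith
  have : ∀ i j : Fin n, scmWeight n i j * scmWeight n i j =
      (1 / ((n : ℝ) - 1)) ^ 2 * ((if i = j then 1 - 2 / (n : ℝ) else 0) + 1 / (n : ℝ) ^ 2) :=
    fun i j => by
      unfold scmWeight
      split_ifs <;> ring
  simp only [this, ← Finset.mul_sum, Finset.sum_add_distrib, Finset.sum_ite_eq, Finset.mem_univ,
    if_true, Finset.sum_const, Finset.card_univ, Fintype.card_fin, nsmul_eq_mul]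
  field_simp
  ring

theorem memLp_sampleCov (hn : 2 ≤ n)
    (hfourth : ∀ j, MemLp (fun x : Fin p → ℝ => x j) 4 ν)
    (hlaw : ∀ i, HasLaw (X i) ν P) (a b : Fin p) :
    MemLp (fun ω => sampleCov (fun i => X i ω) a b) 2 P := by
  have hY : ∀ i a, MemLp (fun ω => X i ω a - (0 : Fin p → ℝ) a) 4 P := fun i a =>
    (memLp_comp_of_hasLaw (hlaw i) (hfourth a)).sub (memLp_const _)
  simp only [fun ω => sampleCov_apply hn (fun i => X i ω) 0]
  exact memLp_finsetSum _ fun i _ => memLp_finsetSum _ fun j _ =>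
    (memLp_two_mul_of_four (hY i a) (hY j b)).const_mul _

theorem integral_sampleCov (hn : 2 ≤ n) (hν : IsElliptical ν μ M g)
    (hfourth : ∀ j, MemLp (fun x : Fin p → ℝ => x j) 4 ν)
    (hlaw : ∀ i, HasLaw (X i) ν P) (hindep : iIndepFun X P) (a b : Fin p) :
    ∫ ω, sampleCov (fun i => X i ω) a b ∂P = M a b := by
  have hY : ∀ i a, MemLp (fun ω => X i ω a - μ a) 4 P := fun i a =>
    (memLp_comp_of_hasLaw (hlaw i) (hfourth a)).sub (memLp_const _)
  have hint : ∀ i j, Integrable (fun ω => scmWeight n i j *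
      ((X i ω a - μ a) * (X j ω b - μ b))) P := fun i j =>
    ((memLp_two_mul_of_four (hY i a) (hY j b)).integrable (by norm_num)).const_mul _
  simp only [fun ω => sampleCov_apply hn (fun i => X i ω) μ]
  rw [integral_finsetSum _ fun i _ => integrable_finsetSum _ fun j _ => hint i j]
  have : ∀ i, ∫ ω, ∑ j, scmWeight n i j * ((X i ω a - μ a) * (X j ω b - μ b)) ∂P =
      scmWeight n i i * M a b := fun i => by
    rw [integral_finsetSum _ fun j _ => hint i j]
    simp [integral_const_mul, integral_mul_of_sample hν hlaw hindep]
  simp only [this, ← Finset.sum_mul, sum_scmWeight_diag hn, one_mul]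

theorem integral_sampleCov_mul (hn : 2 ≤ n) (hν : IsElliptical ν μ M g)
    (hfourth : ∀ j, MemLp (fun x : Fin p → ℝ => x j) 4 ν)
    (hlaw : ∀ i, HasLaw (X i) ν P) (hindep : iIndepFun X P) (a b c d : Fin p) :
    ∫ ω, sampleCov (fun i => X i ω) a b * sampleCov (fun i => X i ω) c d ∂P =
      ellipticalKurtosis ν μ M / n * (M a b * M c d + M a c * M b d + M a d * M b c) +
      (M a b * M c d + 1 / ((n : ℝ) - 1) * (M a c * M b d + M a d * M b c)) := by
  have hY : ∀ i a, MemLp (fun ω => X i ω a - μ a) 4 P := fun i a =>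
    (memLp_comp_of_hasLaw (hlaw i) (hfourth a)).sub (memLp_const _)
  have hexp : ∀ ω, sampleCov (fun i => X i ω) a b * sampleCov (fun i => X i ω) c d =
      ∑ i, ∑ j, ∑ k, ∑ l, scmWeight n i j * scmWeight n k l * ((X i ω a - μ a) *
        (X j ω b - μ b) * ((X k ω c - μ c) * (X l ω d - μ d))) := fun ω => by
    rw [sampleCov_apply hn _ μ, sampleCov_apply hn _ μ]
    simp only [Finset.sum_mul]
    simp only [Finset.mul_sum]
    exact Finset.sum_congr rfl fun i _ => Finset.sum_congr rfl fun j _ =>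
      Finset.sum_congr rfl fun k _ => Finset.sum_congr rfl fun l _ => by ring
  have hint : ∀ i j k l, Integrable (fun ω => scmWeight n i j * scmWeight n k l *
      ((X i ω a - μ a) * (X j ω b - μ b) * ((X k ω c - μ c) * (X l ω d - μ d)))) P :=
    fun i j k l => (integrable_four_mul (hY i a) (hY j b) (hY k c) (hY l d)).const_mul _
  have hE : ∫ ω, sampleCov (fun i => X i ω) a b * sampleCov (fun i => X i ω) c d ∂P =
      ∑ i, ∑ j, ∑ k, ∑ l, scmWeight n i j * scmWeight n k l * (
      ellipticalKurtosis ν μ M * (M a b * M c d + M a c * M b d + M a d * M b c) *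
        (if i = j ∧ i = k ∧ i = l then 1 else 0) +
      ((if i = j ∧ k = l then M a b * M c d else 0) +
        (if i = k ∧ j = l then M a c * M b d else 0) +
        (if i = l ∧ j = k then M a d * M b c else 0))) := by
    simp only [hexp]
    rw [integral_finsetSum _ fun i _ => integrable_finsetSum _ fun j _ =>
      integrable_finsetSum _ fun k _ => integrable_finsetSum _ fun l _ => hint i j k l]
    refine Finset.sum_congr rfl fun i _ => ?_
    rw [integral_finsetSum _ fun j _ => integrable_finsetSum _ fun k _ =>
      integrable_finsetSum _ fun l _ => hint i j k l]
    refine Finset.sum_congr rfl fun j _ => ?_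
    rw [integral_finsetSum _ fun k _ => integrable_finsetSum _ fun l _ => hint i j k l]
    refine Finset.sum_congr rfl fun k _ => ?_
    rw [integral_finsetSum _ fun l _ => hint i j k l]
    refine Finset.sum_congr rfl fun l _ => ?_
    rw [integral_const_mul, integral_four_mul_of_sample hν hfourth hlaw hindep]
  rw [hE]
  -- Total coincidence of the indices leaves `∑ wᵢᵢ² = 1 / n`, the pairing `i = j, k = l` leaves `(∑
  -- wᵢᵢ)² = 1`, and each crossed pairing leaves `∑ wᵢⱼ² = 1 / (n - 1)`, by symmetry of the weights.
  simp only [mul_add, Finset.sum_add_distrib, ite_and, mul_ite, mul_one, mul_zero,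
    Finset.sum_ite_eq, Finset.sum_ite_irrel, Finset.sum_const_zero, Finset.mem_univ, if_true,
    ← Finset.sum_mul, ← Finset.mul_sum, sum_scmWeight_diag hn, sum_scmWeight_diag_sq hn,
    sum_scmWeight_sq hn, fun i j : Fin n => scmWeight_symm j i]
  ring

end Sample

/-! ### The commutation matrix and the conclusion -/

theorem one_add_commutationMatrix_mul_kronecker {p : ℕ} (M : Matrix (Fin p) (Fin p) ℝ)
    (a b : Fin p × Fin p) :
    ((1 + commutationMatrix p) * (M ⊗ₖ M)) a b =
      M a.1 b.1 * M a.2 b.2 + M a.2 b.1 * M a.1 b.2 := by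
  -- `K` is the permutation matrix of the swap of the two indices.
  have hK : ∀ c, commutationMatrix p a c = if a.swap = c then 1 else 0 := fun c => by
    simp only [commutationMatrix, Matrix.sum_apply, Matrix.kroneckerMap_apply, Matrix.single_apply]
    rw [Finset.sum_eq_single a.1 (fun i _ hi => by simp [hi]) (by simp),
      Finset.sum_eq_single a.2 (fun i _ hi => by simp [hi]) (by simp)]
    simp only [Prod.ext_iff, Prod.fst_swap, Prod.snd_swap, true_and, ite_and, mul_ite,
      mul_one, mul_zero, eq_comm]
    split_ifs <;> rfl
  rw [add_mul, one_mul, Matrix.add_apply, Matrix.mul_apply]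
  simp [hK, Matrix.kroneckerMap_apply]

end EllipticalSCM

theorem theorem2 {Ω : Type*} [MeasurableSpace Ω] (P : Measure Ω) [IsProbabilityMeasure P]
    {n p : ℕ} (hn : 2 ≤ n)
    (ν : Measure (Fin p → ℝ)) (μ : Fin p → ℝ) (M : Matrix (Fin p) (Fin p) ℝ) (g : ℝ → ℝ)
    (hν : EllipticalSCM.IsElliptical ν μ M g)
    (hfourth : ∀ j, MemLp (fun x : Fin p → ℝ => x j) 4 ν)
    (X : Fin n → Ω → Fin p → ℝ)
    (hlaw : ∀ i, HasLaw (X i) ν P) (hindep : iIndepFun X P) :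
    (∀ a, MemLp (fun ω => (EllipticalSCM.sampleCov fun i => X i ω).vec a) 2 P) ∧
    EllipticalSCM.covMatrix P (fun ω => (EllipticalSCM.sampleCov fun i => X i ω).vec) =
      (1 / ((n : ℝ) - 1) + EllipticalSCM.ellipticalKurtosis ν μ M / (n : ℝ)) •
          ((1 + EllipticalSCM.commutationMatrix p) * (M ⊗ₖ M)) +
        (EllipticalSCM.ellipticalKurtosis ν μ M / (n : ℝ)) •
          Matrix.vecMulVec M.vec M.vec := by
  have hL2 : ∀ a, MemLp (fun ω => (EllipticalSCM.sampleCov fun i => X i ω).vec a) 2 P := fun a =>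
    -- Stacking columns puts the column index first, hence the reversed order.
    EllipticalSCM.memLp_sampleCov hn hfourth hlaw a.2 a.1
  refine ⟨hL2, ?_⟩
  ext a b
  rw [Matrix.add_apply, Matrix.smul_apply, Matrix.smul_apply,
    EllipticalSCM.one_add_commutationMatrix_mul_kronecker, EllipticalSCM.covMatrix,
    Matrix.of_apply, covariance_eq_sub (hL2 a) (hL2 b)]
  simp only [Pi.mul_apply, Matrix.vec, Matrix.vecMulVec_apply, smul_eq_mul,
    EllipticalSCM.integral_sampleCov_mul hn hν hfourth hlaw hindep,
    EllipticalSCM.integral_sampleCov hn hν hfourth hlaw hindep]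
  -- The product of the means cancels the uncrossed Gaussian pairing; what remains of `vec M (vec
  -- M)ᵀ` has coefficient `κ / n`.
  ring
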